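/- Let $0<p<1$, let $I\subseteq\mathbb R$ be an interval (possibly $I=\mathbb R$), and let functions be real- or complex-valued. Let $L^p=L^p(I)$ with the quasi-norm $\|f\|_p=\left(\int_I|f|^p\right)^{1/p}$. For an integer $k\ge 0$ let $W^{k,p}=W^{k,p}(I)$ be the abstract completion of the space $C_0^\infty(\mathbb R)$, restricted to $I$, in the quasi-norm $$\|f\|_{W^{k,p}}=\left(\|f\|_p^p+\|f'\|_p^p+\dots+\|f^{(k)}\|_p^p\right)^{1/p};$$ its elements are Cauchy sequences $\{f_j\}$ in this quasi-norm, two of them being identified if their difference tends to $0$. Let $\alpha:W^{k,p}\to L^p$, $\alpha\{f_j\}=\lim_j f_j$ (limit in $L^p$), and, for $k\ge1$, $\delta:W^{k,p}\to W^{k-1,p}$, $\delta\{f_j\}=\{f_j'\}$, be the canonical continuous linear maps. Then for every $k\ge 1$: (i) the map $\delta:W^{k,p}\to W^{k-1,p}$ is surjective; (ii) there is a continuous linear map $\beta:L^p\to W^{k,p}$ with $\alpha\circ\beta=\mathrm{id}$ and $\delta\circ\beta=0$; it is injective, it is the only continuous linear map with these two properties, and $\ker\delta=\operatorname{im}\beta$;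 (iii) there is a continuous linear map $\gamma:W^{k-1,p}\to W^{k,p}$ with $\delta\circ\gamma=\mathrm{id}$ and $\alpha\circ\gamma=0$. -/

import Mathlib

open MeasureTheory Filter Topology
open scoped ENNReal Distributions

noncomputable section

namespace SmallSobolev

variable {𝕜 : Type*} [RCLike 𝕜]

/-! ## Elementary inequalities for `0 < p < 1` -/

lemma p_pos (p : Set.Ioo (0 : ℝ) 1) : 0 < (p : ℝ) := p.2.1

lemma ofReal_p_ne_zero (p : Set.Ioo (0 : ℝ) 1) : ENNReal.ofReal p ≠ 0 := by
  simpa using p_pos p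

lemma toReal_ofReal_p (p : Set.Ioo (0 : ℝ) 1) : (ENNReal.ofReal p).toReal = p :=
  ENNReal.toReal_ofReal (p_pos p).le

lemma integrable_pow {μ : Measure ℝ} {p : Set.Ioo (0 : ℝ) 1} {F : ℝ → 𝕜}
    (hF : MemLp F (ENNReal.ofReal p) μ) : Integrable (fun x => ‖F x‖ ^ (p : ℝ)) μ := by
  have := hF.integrable_norm_rpow (ofReal_p_ne_zero p) ENNReal.ofReal_ne_top
  rwa [toReal_ofReal_p] at this

lemma integral_pow_add_le {μ : Measure ℝ} {p : Set.Ioo (0 : ℝ) 1} {F G : ℝ → 𝕜}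
    (hF : MemLp F (ENNReal.ofReal p) μ) (hG : MemLp G (ENNReal.ofReal p) μ) :
    ∫ x, ‖F x + G x‖ ^ (p : ℝ) ∂μ ≤
      ∫ x, ‖F x‖ ^ (p : ℝ) ∂μ + ∫ x, ‖G x‖ ^ (p : ℝ) ∂μ := by
  rw [← integral_add (integrable_pow hF) (integrable_pow hG)]
  refine integral_mono (integrable_pow (hF.add hG))
    ((integrable_pow hF).add (integrable_pow hG)) fun x => ?_
  exact (Real.rpow_le_rpow (norm_nonneg _) (norm_add_le _ _) (p_pos p).le).trans
    (Real.rpow_add_le_add_rpow (norm_nonneg _) (norm_nonneg _) (p_pos p).le p.2.2.le)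

lemma integral_pow_smul (μ : Measure ℝ) (p : Set.Ioo (0 : ℝ) 1) (c : 𝕜) (F : ℝ → 𝕜) :
    ∫ x, ‖c * F x‖ ^ (p : ℝ) ∂μ = ‖c‖ ^ (p : ℝ) * ∫ x, ‖F x‖ ^ (p : ℝ) ∂μ := by
  rw [← integral_const_mul]
  congr 1 with x
  rw [norm_mul, Real.mul_rpow (norm_nonneg _) (norm_nonneg _)]

/-! ## The space `L^p(I)` -/

variable (𝕜) in
/-- The space `L^p(I)`, `0 < p < 1`, of (classes of) `𝕜`-valued functions. Its topology is that of
the quasi-norm `‖f‖_p = (∫_I |f|^p)^(1/p)`, that is, of the invariant metric `‖f - g‖_p ^ p`. -/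
def LpSpace (I : Set ℝ) (p : Set.Ioo (0 : ℝ) 1) : Type _ :=
  Lp 𝕜 (ENNReal.ofReal p) (volume.restrict I)

namespace LpSpace

variable {I : Set ℝ} {p : Set.Ioo (0 : ℝ) 1}

instance : AddCommGroup (LpSpace 𝕜 I p) :=
  inferInstanceAs (AddCommGroup (Lp 𝕜 (ENNReal.ofReal p) (volume.restrict I)))

instance : Module 𝕜 (LpSpace 𝕜 I p) :=
  inferInstanceAs (Module 𝕜 (Lp 𝕜 (ENNReal.ofReal p) (volume.restrict I)))

/-- The underlying class of functions. -/
def toLp (f : LpSpace 𝕜 I p) : Lp 𝕜 (ENNReal.ofReal p) (volume.restrict I) := f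

/-- The class in `L^p(I)` of a function. -/
def mk (F : ℝ → 𝕜) (hF : MemLp F (ENNReal.ofReal p) (volume.restrict I)) : LpSpace 𝕜 I p :=
  hF.toLp F

/-- The quasi-norm `(∫_I |f|^p)^(1/p)`. -/
def quasiNorm (f : LpSpace 𝕜 I p) : ℝ := (∫ x in I, ‖f.toLp x‖ ^ (p : ℝ)) ^ (1 / (p : ℝ))

/-- The metric structure. The number `‖f‖` of this instance is `∫_I |f|^p`, the `p`-th power of the
quasi-norm; it is subadditive. -/
instance : NormedAddCommGroup (LpSpace 𝕜 I p) :=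
  AddGroupNorm.toNormedAddCommGroup
    { toFun := fun f => ∫ x in I, ‖f.toLp x‖ ^ (p : ℝ)
      map_zero' := by
        have : ∀ᵐ x ∂(volume.restrict I),
            ‖(0 : LpSpace 𝕜 I p).toLp x‖ ^ (p : ℝ) = 0 := by
          filter_upwards [Lp.coeFn_zero 𝕜 (ENNReal.ofReal p) (volume.restrict I)] with x hx
          rw [show (0 : LpSpace 𝕜 I p).toLp x = 0 from hx, norm_zero,
            Real.zero_rpow (p_pos p).ne']
        rw [integral_congr_ae this, integral_zero]
      add_le' := fun f g => by
        refine le_trans (le_of_eq ?_) (integral_pow_add_le (Lp.memLp f.toLp) (Lp.memLp g.toLp))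
        refine integral_congr_ae ?_
        filter_upwards [Lp.coeFn_add f.toLp g.toLp] with x hx
        rw [show (f + g).toLp x = f.toLp x + g.toLp x from hx]
      neg' := fun f => by
        refine integral_congr_ae ?_
        filter_upwards [Lp.coeFn_neg f.toLp] with x hx
        rw [show (-f).toLp x = -f.toLp x from hx, norm_neg]
      eq_zero_of_map_eq_zero' := fun f hf => by
        rw [integral_eq_zero_iff_of_nonneg (fun x => by positivity)
          (integrable_pow (Lp.memLp f.toLp))] at hf
        change f.toLp = 0
        rw [Lp.eq_zero_iff_ae_eq_zero]
        filter_upwards [hf] with x hx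
        simpa using (Real.rpow_eq_zero (norm_nonneg _) (p_pos p).ne').1 hx }

lemma norm_def (f : LpSpace 𝕜 I p) : ‖f‖ = ∫ x in I, ‖f.toLp x‖ ^ (p : ℝ) := rfl

lemma norm_eq_quasiNorm_rpow (f : LpSpace 𝕜 I p) : ‖f‖ = f.quasiNorm ^ (p : ℝ) := by
  rw [norm_def, quasiNorm, one_div, Real.rpow_inv_rpow
    (integral_nonneg fun x => by positivity) (p_pos p).ne']

lemma norm_mk (F : ℝ → 𝕜) (hF : MemLp F (ENNReal.ofReal p) (volume.restrict I)) :
    ‖(mk F hF : LpSpace 𝕜 I p)‖ = ∫ x in I, ‖F x‖ ^ (p : ℝ) := by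
  refine integral_congr_ae ?_
  filter_upwards [hF.coeFn_toLp] with x hx
  rw [show (mk F hF : LpSpace 𝕜 I p).toLp x = F x from hx]

lemma norm_smul_eq (c : 𝕜) (f : LpSpace 𝕜 I p) : ‖c • f‖ = ‖c‖ ^ (p : ℝ) * ‖f‖ := by
  rw [norm_def, norm_def, ← integral_pow_smul]
  refine integral_congr_ae ?_
  filter_upwards [Lp.coeFn_smul c f.toLp] with x hx
  rw [show (c • f).toLp x = c * f.toLp x from hx]

instance : UniformContinuousConstSMul 𝕜 (LpSpace 𝕜 I p) where
  uniformContinuous_const_smul c :=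
    AddMonoidHomClass.uniformContinuous_of_bound (DistribSMul.toAddMonoidHom (LpSpace 𝕜 I p) c)
      (‖c‖ ^ (p : ℝ)) fun f => (norm_smul_eq c f).le

lemma dist_eq (f g : LpSpace 𝕜 I p) :
    dist f g = ∫ x in I, ‖f.toLp x - g.toLp x‖ ^ (p : ℝ) := by
  rw [dist_eq_norm, norm_def]
  refine integral_congr_ae ?_
  filter_upwards [Lp.coeFn_sub f.toLp g.toLp] with x hx
  rw [show (f - g).toLp x = f.toLp x - g.toLp x from hx]

lemma eLpNorm_eq {F : ℝ → 𝕜} (hF : MemLp F (ENNReal.ofReal p) (volume.restrict I)) :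
    eLpNorm F (ENNReal.ofReal p) (volume.restrict I) =
      ENNReal.ofReal ((∫ x in I, ‖F x‖ ^ (p : ℝ)) ^ (p : ℝ)⁻¹) := by
  have := hF.eLpNorm_eq_integral_rpow_norm (ofReal_p_ne_zero p) ENNReal.ofReal_ne_top
  rwa [toReal_ofReal_p] at this

lemma ae_tendsto (f : ℕ → LpSpace 𝕜 I p)
    (hf : ∀ N n m : ℕ, N ≤ n → N ≤ m → dist (f n) (f m) < (1 / 2 : ℝ) ^ N) :
    ∀ᵐ x ∂(volume.restrict I), ∃ l : 𝕜, Tendsto (fun n => (f n).toLp x) atTop (𝓝 l) := by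
  have hmem (n : ℕ) : MemLp (fun x => (f (n + 1)).toLp x - (f n).toLp x) (ENNReal.ofReal p)
      (volume.restrict I) := (Lp.memLp (f (n + 1)).toLp).sub (Lp.memLp (f n).toLp)
  have hint : ∫⁻ x in I, ∑' n, ENNReal.ofReal
      (‖(f (n + 1)).toLp x - (f n).toLp x‖ ^ (p : ℝ)) ≠ ∞ := by
    rw [lintegral_tsum fun n => (integrable_pow (hmem n)).aemeasurable.ennreal_ofReal]
    have hle : ∀ n, ∫⁻ x in I, ENNReal.ofReal (‖(f (n + 1)).toLp x - (f n).toLp x‖ ^ (p : ℝ)) ≤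
        ENNReal.ofReal ((1 / 2 : ℝ) ^ n) := fun n => by
      rw [← ofReal_integral_eq_lintegral_ofReal (integrable_pow (hmem n))
        (ae_of_all _ fun x => by positivity), ← dist_eq]
      exact ENNReal.ofReal_le_ofReal (hf n (n + 1) n (Nat.le_succ n) le_rfl).le
    refine ne_top_of_le_ne_top ?_ (ENNReal.tsum_le_tsum hle)
    rw [← ENNReal.ofReal_tsum_of_nonneg (fun n => by positivity) summable_geometric_two]
    exact ENNReal.ofReal_ne_top
  have hae := ae_lt_top' (AEMeasurable.tsum fun n =>
    (integrable_pow (hmem n)).aemeasurable.ennreal_ofReal) hint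
  filter_upwards [hae] with x hx
  have hs : Summable fun n => ‖(f (n + 1)).toLp x - (f n).toLp x‖ ^ (p : ℝ) := by
    have := ENNReal.summable_toReal hx.ne
    refine this.congr fun n => ?_
    rw [ENNReal.toReal_ofReal (by positivity)]
  have hs' : Summable fun n => (f (n + 1)).toLp x - (f n).toLp x := by
    refine Summable.of_norm_bounded_eventually_nat hs ?_
    filter_upwards [hs.tendsto_atTop_zero.eventually (gt_mem_nhds one_pos)] with n hn
    have h1 : ‖(f (n + 1)).toLp x - (f n).toLp x‖ ≤ 1 := by
      by_contra! h
      exact absurd hn (not_lt.2 (Real.one_le_rpow h.le (p_pos p).le))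
    simpa using Real.rpow_le_rpow_of_exponent_ge' (norm_nonneg _) h1 (p_pos p).le p.2.2.le
  have ht := hs'.hasSum.tendsto_sum_nat
  rw [funext fun n => Finset.sum_range_sub (fun m => (f m).toLp x) n] at ht
  exact ⟨_, by simpa using ht.add_const ((f 0).toLp x)⟩

instance : CompleteSpace (LpSpace 𝕜 I p) := by
  refine Metric.complete_of_convergent_controlled_sequences (fun n => (1 / 2 : ℝ) ^ n)
    (fun n => by positivity) fun f hf => ?_
  have hmem (n : ℕ) := Lp.memLp (f n).toLp
  obtain ⟨F, hFm, hF⟩ := exists_stronglyMeasurable_limit_of_tendsto_ae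
    (fun n => (hmem n).1) (ae_tendsto f hf)
  have hB : ∑' n : ℕ, ENNReal.ofReal ((1 / 2 : ℝ) ^ n) ≠ ∞ := by
    rw [← ENNReal.ofReal_tsum_of_nonneg (fun n => by positivity) summable_geometric_two]
    exact ENNReal.ofReal_ne_top
  have hlim := Lp.cauchy_tendsto_of_tendsto (p := ENNReal.ofReal p) (fun n => (hmem n).1) F hB
    (fun N n m hn hm => by
      rw [eLpNorm_eq ((hmem n).sub (hmem m)),
        ENNReal.ofReal_lt_ofReal_iff (by positivity)]
      have h := hf N n m hn hm
      rw [dist_eq] at h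
      have hp1 : 1 ≤ (p : ℝ)⁻¹ := (one_le_inv₀ (p_pos p)).2 p.2.2.le
      refine (Real.rpow_lt_rpow (integral_nonneg fun x => by positivity) h
        (inv_pos.2 (p_pos p))).trans_le ?_
      simpa using Real.rpow_le_rpow_of_exponent_ge' (x := (1 / 2 : ℝ) ^ N) (by positivity)
        (pow_le_one₀ (by norm_num) (by norm_num)) zero_le_one hp1) hF
  have hsub : ∀ᶠ n in atTop, MemLp (⇑(f n).toLp - F) (ENNReal.ofReal p) (volume.restrict I) := by
    filter_upwards [hlim.eventually (gt_mem_nhds one_pos)] with n hn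
    exact ⟨(hmem n).1.sub hFm.aestronglyMeasurable, hn.trans ENNReal.one_lt_top⟩
  have hFmem : MemLp F (ENNReal.ofReal p) (volume.restrict I) := by
    obtain ⟨n, hn⟩ := hsub.exists
    simpa using (hmem n).sub hn
  refine ⟨mk F hFmem, ?_⟩
  rw [tendsto_iff_dist_tendsto_zero]
  have h1 : Tendsto (fun n => (eLpNorm (⇑(f n).toLp - F) (ENNReal.ofReal p)
      (volume.restrict I)).toReal ^ (p : ℝ)) atTop (𝓝 0) := by
    have h2 := (ENNReal.tendsto_toReal ENNReal.zero_ne_top).comp hlim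
    have h3 := h2.rpow_const (p := (p : ℝ)) (Or.inr (p_pos p).le)
    simpa [Real.zero_rpow (p_pos p).ne'] using h3
  refine h1.congr fun n => ?_
  have hmn := (hmem n).sub hFmem
  rw [eLpNorm_eq hmn, ENNReal.toReal_ofReal (by positivity), Real.rpow_inv_rpow
    (integral_nonneg fun x => by positivity) (p_pos p).ne', dist_eq]
  refine integral_congr_ae ?_
  filter_upwards [hFmem.coeFn_toLp] with x hx
  rw [show (mk F hFmem : LpSpace 𝕜 I p).toLp x = F x from hx]
  rfl

end LpSpace

/-! ## The Sobolev space `W^{k,p}(I)` -/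

variable (𝕜) in
/-- The space `C_0^∞(ℝ)` of smooth compactly supported functions on `ℝ`, to be equipped with the
quasi-norm of `W^{k,p}(I)`, which sees only the restrictions of the functions to `I`. -/
def TestSpace (_I : Set ℝ) (_k : ℕ) (_p : Set.Ioo (0 : ℝ) 1) : Type _ :=
  𝓓((⊤ : TopologicalSpace.Opens ℝ), 𝕜)

namespace TestSpace

variable {I : Set ℝ} {k : ℕ} {p : Set.Ioo (0 : ℝ) 1}

instance : AddCommGroup (TestSpace 𝕜 I k p) :=
  inferInstanceAs (AddCommGroup 𝓓((⊤ : TopologicalSpace.Opens ℝ), 𝕜))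

instance : Module 𝕜 (TestSpace 𝕜 I k p) :=
  inferInstanceAs (Module 𝕜 𝓓((⊤ : TopologicalSpace.Opens ℝ), 𝕜))

/-- The underlying test function. -/
def toTest (f : TestSpace 𝕜 I k p) : 𝓓((⊤ : TopologicalSpace.Opens ℝ), 𝕜) := f

/-- A smooth compactly supported function as an element of the space. -/
def mk (F : ℝ → 𝕜) (hF : ContDiff ℝ ((⊤ : ℕ∞) : WithTop ℕ∞) F) (hc : HasCompactSupport F) :
    TestSpace 𝕜 I k p :=
  (⟨F, hF, hc, fun _ _ => trivial⟩ : 𝓓((⊤ : TopologicalSpace.Opens ℝ), 𝕜))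

lemma contDiff (f : TestSpace 𝕜 I k p) : ContDiff ℝ ((⊤ : ℕ∞) : WithTop ℕ∞) f.toTest :=
  TestFunction.contDiff f.toTest

lemma contDiffAt (f : TestSpace 𝕜 I k p) (i : ℕ) (x : ℝ) : ContDiffAt ℝ i f.toTest x :=
  (f.contDiff.of_le (by exact_mod_cast le_top)).contDiffAt

lemma hasCompactSupport (f : TestSpace 𝕜 I k p) : HasCompactSupport f.toTest :=
  TestFunction.hasCompactSupport f.toTest

lemma memLp_iteratedDeriv (f : TestSpace 𝕜 I k p) (i : ℕ) :
    MemLp (iteratedDeriv i f.toTest) (ENNReal.ofReal p) (volume.restrict I) := by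
  refine Continuous.memLp_of_hasCompactSupport
    (f.contDiff.continuous_iteratedDeriv i (by exact_mod_cast le_top)) ?_
  induction i with
  | zero => simpa using f.hasCompactSupport
  | succ i ih => rw [iteratedDeriv_succ]; exact ih.deriv

lemma iteratedDeriv_add (f g : TestSpace 𝕜 I k p) (i : ℕ) (x : ℝ) :
    iteratedDeriv i (f + g).toTest x =
      iteratedDeriv i f.toTest x + iteratedDeriv i g.toTest x :=
  _root_.iteratedDeriv_add (f.contDiffAt i x) (g.contDiffAt i x)

lemma iteratedDeriv_smul (c : 𝕜) (f : TestSpace 𝕜 I k p) (i : ℕ) (x : ℝ) :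
    iteratedDeriv i (c • f).toTest x = c * iteratedDeriv i f.toTest x :=
  iteratedDeriv_const_smul (f.contDiffAt i x) c

/-- The Sobolev quasi-norm `(‖f‖_p^p + ‖f'‖_p^p + … + ‖f^(k)‖_p^p)^(1/p)`, all the `L^p`-quasi-norms
being over `I`. -/
def quasiNorm (f : TestSpace 𝕜 I k p) : ℝ :=
  (∑ i ∈ Finset.range (k + 1), ∫ x in I, ‖iteratedDeriv i f.toTest x‖ ^ (p : ℝ)) ^ (1 / (p : ℝ))

/-- The (pseudo-)metric structure given by the Sobolev quasi-norm. The number `‖f‖` of this instance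
is the `p`-th power of the quasi-norm; it is subadditive. -/
instance : SeminormedAddCommGroup (TestSpace 𝕜 I k p) :=
  AddGroupSeminorm.toSeminormedAddCommGroup
    { toFun := fun f =>
        ∑ i ∈ Finset.range (k + 1), ∫ x in I, ‖iteratedDeriv i f.toTest x‖ ^ (p : ℝ)
      map_zero' := by
        refine Finset.sum_eq_zero fun i _ => ?_
        have h : ∀ x, iteratedDeriv i (0 : TestSpace 𝕜 I k p).toTest x = 0 := fun x => by
          simpa using iteratedDeriv_smul (0 : 𝕜) (0 : TestSpace 𝕜 I k p) i x
        simp [h, Real.zero_rpow (p_pos p).ne']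
      add_le' := fun f g => by
        rw [← Finset.sum_add_distrib]
        refine Finset.sum_le_sum fun i _ => ?_
        simp_rw [iteratedDeriv_add]
        exact integral_pow_add_le (f.memLp_iteratedDeriv i) (g.memLp_iteratedDeriv i)
      neg' := fun f => by
        refine Finset.sum_congr rfl fun i _ => ?_
        have h : ∀ x, iteratedDeriv i (-f).toTest x = -iteratedDeriv i f.toTest x := fun x => by
          simpa using iteratedDeriv_smul (-1 : 𝕜) f i x
        simp_rw [h, norm_neg] }

lemma norm_def (f : TestSpace 𝕜 I k p) : ‖f‖ =
    ∑ i ∈ Finset.range (k + 1), ∫ x in I, ‖iteratedDeriv i f.toTest x‖ ^ (p : ℝ) := rfl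

lemma norm_eq_quasiNorm_rpow (f : TestSpace 𝕜 I k p) : ‖f‖ = f.quasiNorm ^ (p : ℝ) := by
  rw [norm_def, quasiNorm, one_div, Real.rpow_inv_rpow
    (Finset.sum_nonneg fun i _ => integral_nonneg fun x => by positivity) (p_pos p).ne']

lemma norm_smul_eq (c : 𝕜) (f : TestSpace 𝕜 I k p) : ‖c • f‖ = ‖c‖ ^ (p : ℝ) * ‖f‖ := by
  simp_rw [norm_def, iteratedDeriv_smul, integral_pow_smul, Finset.mul_sum]

instance : UniformContinuousConstSMul 𝕜 (TestSpace 𝕜 I k p) where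
  uniformContinuous_const_smul c :=
    AddMonoidHomClass.uniformContinuous_of_bound (DistribSMul.toAddMonoidHom (TestSpace 𝕜 I k p) c)
      (‖c‖ ^ (p : ℝ)) fun f => (norm_smul_eq c f).le

/-- The map `f ↦ f|_I` from test functions to `L^p(I)`. -/
def toLpSpace : TestSpace 𝕜 I k p →L[𝕜] LpSpace 𝕜 I p where
  toFun f := LpSpace.mk f.toTest (by simpa using f.memLp_iteratedDeriv 0)
  map_add' _ _ := rfl
  map_smul' _ _ := rfl
  cont := by
    let A : TestSpace 𝕜 I k p →+ LpSpace 𝕜 I p :=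
      { toFun := fun f => LpSpace.mk f.toTest (by simpa using f.memLp_iteratedDeriv 0)
        map_zero' := rfl
        map_add' := fun _ _ => rfl }
    refine (AddMonoidHomClass.uniformContinuous_of_bound A 1 fun f => ?_).continuous
    rw [one_mul, norm_def, Finset.sum_range_succ']
    refine le_trans (le_of_eq ?_) (le_add_of_nonneg_left
      (Finset.sum_nonneg fun i _ => integral_nonneg fun x => by positivity))
    rw [show A f = LpSpace.mk f.toTest (by simpa using f.memLp_iteratedDeriv 0) from rfl,
      LpSpace.norm_mk]
    simp

/-- The derivative `f ↦ f'` on test functions, as a map from the `W^{k+1,p}`-topology to the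
`W^{k,p}`-topology. -/
def derivCLM : TestSpace 𝕜 I (k + 1) p →L[𝕜] TestSpace 𝕜 I k p :=
  let D : TestSpace 𝕜 I (k + 1) p →ₗ[𝕜] TestSpace 𝕜 I k p :=
    { toFun := fun f => mk (deriv f.toTest)
        ((contDiff_infty_iff_deriv.1 f.contDiff).2) f.hasCompactSupport.deriv
      map_add' := fun f g => TestFunction.ext fun x => by
        simpa [iteratedDeriv_one] using! iteratedDeriv_add f g 1 x
      map_smul' := fun c f => TestFunction.ext fun x => by
        simpa [iteratedDeriv_one] using! iteratedDeriv_smul c f 1 x }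
  { toLinearMap := D
    cont := by
      refine (AddMonoidHomClass.uniformContinuous_of_bound D 1 fun f => ?_).continuous
      have h : ∀ i, iteratedDeriv i (D f).toTest = iteratedDeriv (i + 1) f.toTest :=
        fun i => iteratedDeriv_succ'.symm
      rw [one_mul, norm_def, norm_def, Finset.sum_range_succ' _ (k + 1)]
      simp_rw [h]
      exact le_add_of_nonneg_right (integral_nonneg fun x => by positivity) }

lemma derivCLM_apply (f : TestSpace 𝕜 I (k + 1) p) (x : ℝ) :
    (derivCLM f).toTest x = deriv f.toTest x := rfl

end TestSpace

variable (𝕜) in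
/-- The Sobolev space `W^{k,p}(I)`: the abstract (Hausdorff) completion of `C_0^∞(ℝ)`, restricted to
`I`, in the Sobolev quasi-norm. -/
abbrev W (I : Set ℝ) (k : ℕ) (p : Set.Ioo (0 : ℝ) 1) : Type _ :=
  UniformSpace.Completion (TestSpace 𝕜 I k p)

variable (𝕜) in
/-- The canonical map `α : W^{k,p}(I) → L^p(I)`, `{f_j} ↦ lim f_j`. -/
def alpha (I : Set ℝ) (k : ℕ) (p : Set.Ioo (0 : ℝ) 1) : W 𝕜 I k p →L[𝕜] LpSpace 𝕜 I p :=
  TestSpace.toLpSpace.fromCompletion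

lemma alpha_coe {I : Set ℝ} {k : ℕ} {p : Set.Ioo (0 : ℝ) 1} (f : TestSpace 𝕜 I k p) :
    alpha 𝕜 I k p (f : W 𝕜 I k p) = TestSpace.toLpSpace f :=
  ContinuousLinearMap.fromCompletion_apply_coe _ f

variable (𝕜) in
/-- The canonical map `δ : W^{k+1,p}(I) → W^{k,p}(I)`, `{f_j} ↦ {f_j'}`. -/
def delta (I : Set ℝ) (k : ℕ) (p : Set.Ioo (0 : ℝ) 1) : W 𝕜 I (k + 1) p →L[𝕜] W 𝕜 I k p :=
  TestSpace.derivCLM.completion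

lemma delta_coe {I : Set ℝ} {k : ℕ} {p : Set.Ioo (0 : ℝ) 1} (f : TestSpace 𝕜 I (k + 1) p) :
    delta 𝕜 I k p (f : W 𝕜 I (k + 1) p) = (TestSpace.derivCLM f : TestSpace 𝕜 I k p) :=
  ContinuousLinearMap.completion_apply_coe _ f

end SmallSobolev

end

noncomputable section

namespace SmallSobolev

variable {𝕜 : Type*} [RCLike 𝕜]

/-! ## Smooth staircases with small derivatives in `L^p` -/

/-! For `p < 1` a function can climb from 0 to 1 at almost no cost: a slope of order `1/h` on an
interval of length of order `h` contributes about `h^(1-p)` to `∫ |s'|^p`, which tends to 0 with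
`h`. Averaging repeatedly, with each new window chosen before the staircase that it smooths, makes
any finite number of derivatives small at once (`exists_isStaircase`).

The p-th power of the Sobolev quasi-norm splits exactly as `‖f‖ = ‖α f‖ + ‖δ f‖`, so `(α, δ)` embeds
`W^{k+1,p}` as a closed subspace of `L^p × W^{k,p}`, and surjectivity only requires approximation.
Differences of translated staircases approximate indicators of intervals in `L^p` while their
derivatives tend to 0. Hence `(1_{[a,b)}, 0)` lies in the range, and by linearity and density so
does every `(g, 0)` (`forall_mem_flatSubmodule`). Moreover, a test function is nearly the derivative
of a test function `F`: the nonzero total integral of its primitive is brought back to 0 by a cheap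
staircase (`TestSpace.exists_derivCLM_approx`). Subtracting `(F, 0)` from `(F, F')` then yields
every `(0, w)`. So `(α, δ)` is an isomorphism; `β` and `γ` are its inverse on the two factors. -/

lemma setIntegral_pow_le_of_support (I : Set ℝ) (p : Set.Ioo (0 : ℝ) 1) {F : ℝ → 𝕜} {a b c : ℝ}
    (hab : a ≤ b) (hc : ∀ x, ‖F x‖ ≤ c) (h0 : ∀ x, x ∉ Set.Icc a b → F x = 0) :
    ∫ x in I, ‖F x‖ ^ (p : ℝ) ≤ c ^ (p : ℝ) * (b - a) := by
  have hc0 : 0 ≤ c := (norm_nonneg _).trans (hc 0)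
  have hfin : (volume.restrict I) (Set.Icc a b) ≠ ∞ :=
    ne_top_of_le_ne_top (by simp) (Measure.restrict_apply_le I (Set.Icc a b))
  have h1 : ∫ x in I, ‖F x‖ ^ (p : ℝ) ≤
      ∫ x in I, (Set.Icc a b).indicator (fun _ => c ^ (p : ℝ)) x := by
    refine integral_mono_of_nonneg (ae_of_all _ fun x => by positivity) ?_
      (ae_of_all _ fun x => ?_)
    · exact (integrable_indicator_iff measurableSet_Icc).2 (integrableOn_const hfin)
    · by_cases hx : x ∈ Set.Icc a b
      · simp only [Set.indicator_of_mem hx]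
        exact Real.rpow_le_rpow (norm_nonneg _) (hc x) (p_pos p).le
      · simp [Set.indicator_of_notMem hx, h0 x hx, Real.zero_rpow (p_pos p).ne']
  refine h1.trans ?_
  rw [integral_indicator_const _ measurableSet_Icc, smul_eq_mul, mul_comm]
  refine mul_le_mul_of_nonneg_left ?_ (by positivity)
  rw [Measure.real]
  refine ENNReal.toReal_le_of_le_ofReal (by linarith) ?_
  exact (Measure.restrict_apply_le I (Set.Icc a b)).trans (by simp)

variable (𝕜) in
/-- A smooth function bounded by `1` that rises from `0` to `1` on the interval `[0, L]`. -/
structure IsStaircase (s : ℝ → 𝕜) (L : ℝ) : Prop where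
  contDiff : ContDiff ℝ ((⊤ : ℕ∞) : WithTop ℕ∞) s
  eq_zero : ∀ x ≤ 0, s x = 0
  eq_one : ∀ x, L ≤ x → s x = 1
  norm_le : ∀ x, ‖s x‖ ≤ 1

namespace IsStaircase

variable {s : ℝ → 𝕜} {L : ℝ}

lemma contDiffAt (hs : IsStaircase 𝕜 s L) (i : ℕ) (x : ℝ) : ContDiffAt ℝ i s x :=
  (hs.contDiff.of_le (by exact_mod_cast le_top)).contDiffAt

lemma contDiff_comp_sub (hs : IsStaircase 𝕜 s L) (a : ℝ) :
    ContDiff ℝ ((⊤ : ℕ∞) : WithTop ℕ∞) fun x => s (x - a) :=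
  hs.contDiff.comp (contDiff_id.sub contDiff_const)

/-- Off `[0, L]` the staircase is locally constant, so its derivatives of order at least one have
compact support. Order zero is excluded because `s` is 1 on a half-line. -/
lemma memLp_iteratedDeriv_succ (hs : IsStaircase 𝕜 s L) (i : ℕ) (q : ℝ≥0∞) :
    MemLp (iteratedDeriv (i + 1) s) q volume := by
  refine Continuous.memLp_of_hasCompactSupport
    (hs.contDiff.continuous_iteratedDeriv (i + 1) (by exact_mod_cast le_top)) ?_
  induction i with
  | zero =>
    rw [zero_add, iteratedDeriv_one]
    refine HasCompactSupport.intro (isCompact_Icc (a := 0) (b := L)) fun x hx => ?_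
    rw [Set.mem_Icc, not_and_or, not_le, not_le] at hx
    rcases hx with hx | hx
    · have : s =ᶠ[𝓝 x] fun _ => (0 : 𝕜) := by
        filter_upwards [gt_mem_nhds hx] with y hy using hs.eq_zero y hy.le
      rw [this.deriv_eq, deriv_const]
    · have : s =ᶠ[𝓝 x] fun _ => (1 : 𝕜) := by
        filter_upwards [lt_mem_nhds hx] with y hy using hs.eq_one y hy.le
      rw [this.deriv_eq, deriv_const]
  | succ i ih => rw [iteratedDeriv_succ]; exact ih.deriv

lemma integral_comp_sub (p : Set.Ioo (0 : ℝ) 1) (i : ℕ) (a : ℝ) (c : 𝕜) :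
    ∫ x, ‖iteratedDeriv i (fun y => c * s (y - a)) x‖ ^ (p : ℝ) =
      ‖c‖ ^ (p : ℝ) * ∫ x, ‖iteratedDeriv i s x‖ ^ (p : ℝ) := by
  have : ∀ x, iteratedDeriv i (fun y => c * s (y - a)) x = c * iteratedDeriv i s (x - a) :=
    fun x => by
      rw [iteratedDeriv_const_mul_field, iteratedDeriv_comp_sub_const]
  simp_rw [this]
  rw [integral_pow_smul volume p c (fun x => iteratedDeriv i s (x - a)),
    integral_sub_right_eq_self (fun x => ‖iteratedDeriv i s x‖ ^ (p : ℝ)) a]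

/-- Each end of the plateau contributes one translate of the staircase, and the integral of the p-th
power is subadditive. -/
lemma integral_window_le (hs : IsStaircase 𝕜 s L) (p : Set.Ioo (0 : ℝ) 1) (i : ℕ) (a b : ℝ) :
    ∫ x, ‖iteratedDeriv (i + 1) (fun y => s (y - a) - s (y - b)) x‖ ^ (p : ℝ) ≤
      2 * ∫ x, ‖iteratedDeriv (i + 1) s x‖ ^ (p : ℝ) := by
  have h : ∀ x, iteratedDeriv (i + 1) (fun y => s (y - a) - s (y - b)) x =
      iteratedDeriv (i + 1) s (x - a) + (-1) * iteratedDeriv (i + 1) s (x - b) := fun x => by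
    rw [iteratedDeriv_fun_sub
      ((hs.contDiff_comp_sub a).of_le (by exact_mod_cast le_top)).contDiffAt
      ((hs.contDiff_comp_sub b).of_le (by exact_mod_cast le_top)).contDiffAt,
      iteratedDeriv_comp_sub_const, iteratedDeriv_comp_sub_const]
    ring
  have hm (c : ℝ) : MemLp (fun x => iteratedDeriv (i + 1) s (x - c)) (ENNReal.ofReal p) volume :=
    (hs.memLp_iteratedDeriv_succ i _).comp_measurePreserving
      (measurePreserving_sub_right volume c)
  simp_rw [h]
  refine (integral_pow_add_le (hm a) ((hm b).const_mul (-1))).trans (le_of_eq ?_)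
  rw [integral_pow_smul volume p (-1) (fun x => iteratedDeriv (i + 1) s (x - b)),
    integral_sub_right_eq_self (fun x => ‖iteratedDeriv (i + 1) s x‖ ^ (p : ℝ)) a,
    integral_sub_right_eq_self (fun x => ‖iteratedDeriv (i + 1) s x‖ ^ (p : ℝ)) b]
  simp
  ring

lemma window_eq_zero (hs : IsStaircase 𝕜 s L) {a b : ℝ} (hab : a ≤ b) {x : ℝ}
    (hx : x ∉ Set.Icc a (b + L)) : s (x - a) - s (x - b) = 0 := by
  rw [Set.mem_Icc, not_and_or, not_le, not_le] at hx
  rcases hx with hx | hx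
  · rw [hs.eq_zero _ (by linarith), hs.eq_zero _ (by linarith), sub_zero]
  · rw [hs.eq_one _ (by linarith), hs.eq_one _ (by linarith), sub_self]

/-- The running mean `x ↦ h⁻¹ ∫_{x-h}^x s`. -/
def mean (s : ℝ → 𝕜) (h : ℝ) (x : ℝ) : 𝕜 := (h : 𝕜)⁻¹ * ∫ t in (x - h)..x, s t

lemma hasDerivAt_mean (hs : IsStaircase 𝕜 s L) (h x : ℝ) :
    HasDerivAt (mean s h) ((h : 𝕜)⁻¹ * (s (x - 0) - s (x - h))) x := by
  have hc := hs.contDiff.continuous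
  have h1 (x : ℝ) : HasDerivAt (fun u => ∫ t in (0 : ℝ)..u, s t) (s x) x :=
    (hc.integral_hasStrictDerivAt 0 x).hasDerivAt
  have h2 : HasDerivAt (fun u => ∫ t in (0 : ℝ)..(u - h), s t) (s (x - h)) x :=
    (h1 (x - h)).comp_sub_const x h
  have h3 := ((h1 x).sub h2).const_mul (h : 𝕜)⁻¹
  rw [sub_zero]
  refine h3.congr_of_eventuallyEq (Eventually.of_forall fun u => ?_)
  simp only [mean, Pi.sub_apply]
  rw [intervalIntegral.integral_interval_sub_left (hc.intervalIntegrable _ _)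
    (hc.intervalIntegrable _ _)]

lemma deriv_mean (hs : IsStaircase 𝕜 s L) (h : ℝ) :
    deriv (mean s h) = fun x => (h : 𝕜)⁻¹ * (s (x - 0) - s (x - h)) :=
  funext fun x => (hs.hasDerivAt_mean h x).deriv

/-- For `x ≥ h + L` the whole window `[x - h, x]` lies where `s = 1`; an average of values bounded
by 1 stays bounded by 1. -/
lemma isStaircase_mean (hs : IsStaircase 𝕜 s L) {h : ℝ} (hh : 0 < h) :
    IsStaircase 𝕜 (mean s h) (h + L) where
  contDiff := by
    rw [contDiff_infty_iff_deriv]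
    refine ⟨fun x => (hs.hasDerivAt_mean h x).differentiableAt, ?_⟩
    rw [hs.deriv_mean]
    exact contDiff_const.mul ((hs.contDiff_comp_sub 0).sub (hs.contDiff_comp_sub h))
  eq_zero x hx := by
    rw [mean, intervalIntegral.integral_congr (g := fun _ => (0 : 𝕜))]
    · simp
    · intro t ht
      rw [Set.uIcc_of_le (by linarith)] at ht
      exact hs.eq_zero t (ht.2.trans hx)
  eq_one x hx := by
    rw [mean, intervalIntegral.integral_congr (g := fun _ => (1 : 𝕜))]
    · have : (h : 𝕜) ≠ 0 := by exact_mod_cast hh.ne'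
      rw [intervalIntegral.integral_const, sub_sub_cancel, RCLike.real_smul_eq_coe_mul, mul_one,
        inv_mul_cancel₀ this]
    · intro t ht
      rw [Set.uIcc_of_le (by linarith)] at ht
      exact hs.eq_one t (by linarith [ht.1])
  norm_le x := by
    have := intervalIntegral.norm_integral_le_of_norm_le_const (a := x - h) (b := x) (C := 1)
      (f := s) fun t _ => hs.norm_le t
    rw [sub_sub_cancel, one_mul, abs_of_pos hh] at this
    rw [mean, norm_mul, norm_inv, RCLike.norm_ofReal, abs_of_pos hh]
    exact inv_mul_le_one_of_le₀ this hh.le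

lemma norm_window_le (hs : IsStaircase 𝕜 s L) (a b x : ℝ) : ‖s (x - a) - s (x - b)‖ ≤ 2 :=
  (norm_sub_le _ _).trans (by linarith [hs.norm_le (x - a), hs.norm_le (x - b)])

end IsStaircase

lemma exists_isStaircase_one {L : ℝ} (hL : 0 < L) : ∃ s : ℝ → 𝕜, IsStaircase 𝕜 s L := by
  refine ⟨fun x => ((Real.smoothTransition (x / L) : ℝ) : 𝕜), ?_, fun x hx => ?_, fun x hx => ?_,
    fun x => ?_⟩
  · exact (RCLike.ofRealCLM (K := 𝕜)).contDiff.comp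
      (Real.smoothTransition.contDiff.comp (contDiff_id.div_const L))
  · rw [Real.smoothTransition.zero_of_nonpos (div_nonpos_of_nonpos_of_nonneg hx hL.le)]
    simp
  · rw [Real.smoothTransition.one_of_one_le ((one_le_div hL).2 hx)]
    simp
  · rw [RCLike.norm_ofReal, abs_of_nonneg (Real.smoothTransition.nonneg _)]
    exact Real.smoothTransition.le_one _

/-- The decisive use of `p < 1`: the left side of the last inequality is `2^(p+1) h^(1-p)`. It
bounds the cost of a first derivative of size at most `2/h` on an interval of length `2h`. -/
lemma exists_step_width (p : Set.Ioo (0 : ℝ) 1) {ε : ℝ} (hε : 0 < ε) :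
    ∃ h : ℝ, 0 < h ∧ h ≤ ε / 2 ∧ (h⁻¹ * 2) ^ (p : ℝ) * (h + h) ≤ ε := by
  have h1 : Tendsto (fun h : ℝ => 2 ^ (p : ℝ) * 2 * h ^ (1 - (p : ℝ))) (𝓝 0) (𝓝 0) := by
    have h2 : ContinuousAt (fun h : ℝ => h ^ (1 - (p : ℝ))) 0 :=
      Real.continuousAt_rpow_const _ _ (Or.inr (by linarith [p.2.2]))
    have h3 := h2.tendsto.const_mul (2 ^ (p : ℝ) * 2)
    rwa [Real.zero_rpow (by linarith [p.2.2]), mul_zero] at h3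
  obtain ⟨h, ⟨h2, h3⟩, h4⟩ := (((h1.eventually (gt_mem_nhds hε)).and
    (gt_mem_nhds (half_pos hε))).filter_mono nhdsWithin_le_nhds |>.and
      (self_mem_nhdsWithin (s := Set.Ioi (0 : ℝ)))).exists
  have h5 : 0 < h := h4
  refine ⟨h, h5, h3.le, le_trans (le_of_eq ?_) h2.le⟩
  rw [Real.mul_rpow (by positivity) (by positivity), Real.inv_rpow h5.le,
    Real.rpow_sub h5, Real.rpow_one]
  field_simp
  ring

variable (𝕜) in
-- Induction on the number of controlled derivatives. The first derivative of the mean is `h⁻¹`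
-- times a difference of two translates, controlled by `exists_step_width`; each higher one costs at
-- most `2 h^(-p)` times the cost of a derivative of `s` one order lower, small by induction because
-- `s` is chosen after `h`.
theorem exists_isStaircase (p : Set.Ioo (0 : ℝ) 1) (m : ℕ) : ∀ ε > 0, ∃ s : ℝ → 𝕜,
    IsStaircase 𝕜 s ε ∧ ∀ i < m, ∫ x, ‖iteratedDeriv (i + 1) s x‖ ^ (p : ℝ) ≤ ε := by
  induction m with
  | zero =>
    intro ε hε
    obtain ⟨s, hs⟩ := exists_isStaircase_one (𝕜 := 𝕜) hε
    exact ⟨s, hs, by simp⟩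
  | succ m ih =>
    intro ε hε
    obtain ⟨h, hh, hhε, hhp⟩ := exists_step_width p hε
    -- The bound `η ≤ h` keeps the rise length `h + η` below `2h ≤ ε`; the other bound absorbs the
    -- factor `2 h^(-p)`.
    set η := min h (ε * h ^ (p : ℝ) / 2) with hη
    have hη0 : 0 < η := lt_min hh (by positivity)
    obtain ⟨s, hs, hsi⟩ := ih η hη0
    have hm := hs.isStaircase_mean hh
    refine ⟨IsStaircase.mean s h, ⟨hm.contDiff, hm.eq_zero, fun x hx => hm.eq_one x ?_,
      hm.norm_le⟩, fun i hi => ?_⟩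
    · linarith [min_le_left h (ε * h ^ (p : ℝ) / 2)]
    · rw [iteratedDeriv_succ', hs.deriv_mean]
      rcases i with _ | i
      · rw [iteratedDeriv_zero, ← Measure.restrict_univ (μ := (volume : Measure ℝ))]
        refine le_trans (setIntegral_pow_le_of_support Set.univ p (a := 0) (b := h + h)
          (c := h⁻¹ * 2) (by linarith) (fun x => ?_) fun x hx => ?_) (by simpa using hhp)
        · rw [norm_mul, norm_inv, RCLike.norm_ofReal, abs_of_pos hh]
          exact mul_le_mul_of_nonneg_left (hs.norm_window_le 0 h x) (by positivity)
        · rw [hs.window_eq_zero hh.le, mul_zero]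
          exact fun hx' => hx ⟨hx'.1, hx'.2.trans
            (by linarith [min_le_left h (ε * h ^ (p : ℝ) / 2)])⟩
      · have : ∀ x, iteratedDeriv (i + 1) (fun x => (h : 𝕜)⁻¹ * (s (x - 0) - s (x - h))) x =
            (h : 𝕜)⁻¹ * iteratedDeriv (i + 1) (fun x => s (x - 0) - s (x - h)) x :=
          fun x => iteratedDeriv_const_mul_field _ _
        simp_rw [this]
        rw [integral_pow_smul, norm_inv, RCLike.norm_ofReal, abs_of_pos hh, Real.inv_rpow hh.le]
        have h1 := hs.integral_window_le p i 0 h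
        have h2 := hsi i (by omega)
        have h3 : η ≤ ε * h ^ (p : ℝ) / 2 := min_le_right _ _
        rw [inv_mul_le_iff₀ (by positivity)]
        linarith

/-! ## The isomorphism `W^{k+1,p} ≅ L^p × W^{k,p}` -/

section Isomorphism

variable {I : Set ℝ} {k : ℕ} {p : Set.Ioo (0 : ℝ) 1}

/-- An equality, because `‖·‖` is the p-th power of the quasi-norm: the term of order zero is split
off the sum. -/
lemma TestSpace.norm_succ (f : TestSpace 𝕜 I (k + 1) p) :
    ‖f‖ = ‖(toLpSpace f : LpSpace 𝕜 I p)‖ + ‖(derivCLM f : TestSpace 𝕜 I k p)‖ := by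
  have h : ∀ i, iteratedDeriv i (derivCLM f : TestSpace 𝕜 I k p).toTest =
      iteratedDeriv (i + 1) f.toTest := fun i => iteratedDeriv_succ'.symm
  rw [norm_def, norm_def, Finset.sum_range_succ' _ (k + 1), add_comm]
  simp_rw [h]
  rw [show (toLpSpace f : LpSpace 𝕜 I p) =
    LpSpace.mk f.toTest (by simpa using f.memLp_iteratedDeriv 0) from rfl, LpSpace.norm_mk]
  simp

lemma norm_eq_alpha_add_delta (f : W 𝕜 I (k + 1) p) :
    ‖f‖ = ‖alpha 𝕜 I (k + 1) p f‖ + ‖delta 𝕜 I k p f‖ := by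
  induction f using UniformSpace.Completion.induction_on with
  | hp => exact isClosed_eq (by fun_prop) (by fun_prop)
  | ih f =>
    rw [alpha_coe, delta_coe, UniformSpace.Completion.norm_coe, UniformSpace.Completion.norm_coe]
    exact f.norm_succ

variable (𝕜 I k p) in
/-- The map `(α, δ) : W^{k+1,p} → L^p × W^{k,p}`. -/
def alphaDelta : W 𝕜 I (k + 1) p →L[𝕜] LpSpace 𝕜 I p × W 𝕜 I k p :=
  (alpha 𝕜 I (k + 1) p).prod (delta 𝕜 I k p)

/-- The constant 2 compares the sum of the two norms with the maximum norm of the product. -/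
lemma antilipschitz_alphaDelta : AntilipschitzWith 2 (alphaDelta 𝕜 I k p) := by
  refine AddMonoidHomClass.antilipschitz_of_bound (alphaDelta 𝕜 I k p) fun f => ?_
  rw [norm_eq_alpha_add_delta, Prod.norm_def]
  have h1 := le_max_left ‖alpha 𝕜 I (k + 1) p f‖ ‖delta 𝕜 I k p f‖
  have h2 := le_max_right ‖alpha 𝕜 I (k + 1) p f‖ ‖delta 𝕜 I k p f‖
  change _ ≤ 2 * max ‖alpha 𝕜 I (k + 1) p f‖ ‖delta 𝕜 I k p f‖
  linarith

/-- A bi-Lipschitz image of the complete space `W^{k+1,p}` is closed. From here on, approximating a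
pair suffices to place it in the range. -/
lemma isClosed_range_alphaDelta : IsClosed (Set.range (alphaDelta 𝕜 I k p)) := by
  refine antilipschitz_alphaDelta.isClosed_range
    (AddMonoidHomClass.uniformContinuous_of_bound (alphaDelta 𝕜 I k p) 1 fun f => ?_)
  rw [norm_eq_alpha_add_delta, one_mul]
  exact max_le (le_add_of_nonneg_right (norm_nonneg _)) (le_add_of_nonneg_left (norm_nonneg _))

/-! ### Pairs `(g, 0)`: indicators of intervals -/

variable (𝕜 I k p) in
/-- The classes `g` in `L^p` for which `(g, 0)` is in the range of `(α, δ)`. -/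
def flatSubmodule : Submodule 𝕜 (LpSpace 𝕜 I p) :=
  (LinearMap.range (alphaDelta 𝕜 I k p).toLinearMap).comap (LinearMap.inl 𝕜 _ _)

lemma mem_flatSubmodule {g : LpSpace 𝕜 I p} :
    g ∈ flatSubmodule 𝕜 I k p ↔ (g, 0) ∈ Set.range (alphaDelta 𝕜 I k p) := Iff.rfl

lemma isClosed_flatSubmodule : IsClosed (flatSubmodule 𝕜 I k p : Set (LpSpace 𝕜 I p)) :=
  isClosed_range_alphaDelta.preimage (f := fun g : LpSpace 𝕜 I p => (g, (0 : W 𝕜 I k p)))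
    (by fun_prop)

lemma mem_flatSubmodule_of_approx {g : LpSpace 𝕜 I p} {C : ℝ}
    (h : ∀ ε > 0, ∃ f : TestSpace 𝕜 I (k + 1) p,
      ‖g - TestSpace.toLpSpace f‖ ≤ C * ε ∧ ‖(TestSpace.derivCLM f : TestSpace 𝕜 I k p)‖ ≤ C * ε) :
    g ∈ flatSubmodule 𝕜 I k p := by
  rw [mem_flatSubmodule, ← isClosed_range_alphaDelta.closure_eq, Metric.mem_closure_range_iff]
  intro ε hε
  -- The sign of `C` is not known; `|C| + 1` is positive and exceeds it.
  obtain ⟨f, h1, h2⟩ := h (ε / (|C| + 1)) (by positivity)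
  have h3 : C * (ε / (|C| + 1)) < ε := by
    rw [← mul_div_assoc, div_lt_iff₀ (by positivity)]
    nlinarith [le_abs_self C]
  refine ⟨f, ?_⟩
  rw [dist_eq_norm, Prod.norm_def]
  refine max_lt ?_ ?_
  · change ‖g - alpha 𝕜 I (k + 1) p f‖ < ε
    rw [alpha_coe]
    exact h1.trans_lt h3
  · change ‖0 - delta 𝕜 I k p f‖ < ε
    rw [delta_coe, zero_sub, norm_neg, UniformSpace.Completion.norm_coe]
    exact h2.trans_lt h3

lemma TestSpace.norm_le_of_iteratedDeriv (f : TestSpace 𝕜 I k p) {c : ℝ}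
    (h : ∀ i < k + 1, ∫ x, ‖iteratedDeriv i f.toTest x‖ ^ (p : ℝ) ≤ c) :
    ‖f‖ ≤ (k + 1) * c := by
  rw [norm_def]
  refine (Finset.sum_le_card_nsmul _ _ c fun i hi => ?_).trans (by simp)
  refine le_trans ?_ (h i (Finset.mem_range.1 hi))
  have hm := memLp_iteratedDeriv (I := Set.univ) (k := k) (p := p) f i
  rw [Measure.restrict_univ] at hm
  exact setIntegral_le_integral (integrable_pow hm) (ae_of_all _ fun x => by positivity)

lemma LpSpace.mk_add {F G : ℝ → 𝕜} (hF : MemLp F (ENNReal.ofReal p) (volume.restrict I))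
    (hG : MemLp G (ENNReal.ofReal p) (volume.restrict I)) :
    LpSpace.mk (fun x => F x + G x) (hF.add hG) = LpSpace.mk F hF + LpSpace.mk G hG := rfl

lemma LpSpace.mk_const_mul {F : ℝ → 𝕜} (c : 𝕜)
    (hF : MemLp F (ENNReal.ofReal p) (volume.restrict I)) :
    LpSpace.mk (fun x => c * F x) (hF.const_mul c) = c • LpSpace.mk F hF := rfl

lemma memLp_indicator_Ico (I : Set ℝ) (q : ℝ≥0∞) (a b : ℝ) :
    MemLp ((Set.Ico a b).indicator fun _ => (1 : 𝕜)) q (volume.restrict I) :=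
  memLp_indicator_const q measurableSet_Ico 1
    (Or.inr (ne_top_of_le_ne_top (by simp) (Measure.restrict_apply_le I (Set.Ico a b))))

lemma norm_mk_sub_mk {F G : ℝ → 𝕜} (hF : MemLp F (ENNReal.ofReal p) (volume.restrict I))
    (hG : MemLp G (ENNReal.ofReal p) (volume.restrict I)) :
    ‖(LpSpace.mk F hF - LpSpace.mk G hG : LpSpace 𝕜 I p)‖ =
      ∫ x in I, ‖F x - G x‖ ^ (p : ℝ) :=
  LpSpace.norm_mk (fun x => F x - G x) (hF.sub hG)

/-- The approximants are the plateaus `s(x - a) - s(x - b)`. They differ from the indicator only on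
two intervals of length `ε`, and their derivatives are small by the choice of `s`. -/
lemma indicator_mem_flatSubmodule {a b : ℝ} (hab : a ≤ b) :
    LpSpace.mk ((Set.Ico a b).indicator fun _ => (1 : 𝕜)) (memLp_indicator_Ico I _ a b) ∈
      flatSubmodule 𝕜 I k p := by
  -- The two jumps cost at most `4ε` in `L^p`, the `k + 1` derivatives at most `2ε` each; the
  -- constant dominates both totals.
  refine mem_flatSubmodule_of_approx (C := 2 * (k + 1) + 2) fun ε hε => ?_
  obtain ⟨s, hs, hsi⟩ := exists_isStaircase 𝕜 p (k + 1) ε hε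
  have hcs : HasCompactSupport fun x => s (x - a) - s (x - b) :=
    HasCompactSupport.intro (isCompact_Icc (a := a) (b := b + ε)) fun x hx =>
      hs.window_eq_zero hab hx
  have hk : (0 : ℝ) ≤ k := k.cast_nonneg
  refine ⟨TestSpace.mk (fun x => s (x - a) - s (x - b))
    ((hs.contDiff_comp_sub a).sub (hs.contDiff_comp_sub b)) hcs, ?_, ?_⟩
  · have hstep (c : ℝ) : MemLp ((Set.Icc c (c + ε)).indicator fun _ => (1 : 𝕜)) (ENNReal.ofReal p)
        (volume.restrict I) := memLp_indicator_const _ measurableSet_Icc 1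
      (Or.inr (ne_top_of_le_ne_top (by simp) (Measure.restrict_apply_le I _)))
    refine (le_of_eq (norm_mk_sub_mk _ (((hs.contDiff_comp_sub a).sub
      (hs.contDiff_comp_sub b)).continuous.memLp_of_hasCompactSupport hcs))).trans ?_
    -- the error splits into the errors of the two jumps
    let J (c x : ℝ) : 𝕜 := (Set.Ici c).indicator (fun _ => (1 : 𝕜)) x - s (x - c)
    have hJ0 (c x : ℝ) (hx : x ∉ Set.Icc c (c + ε)) : J c x = 0 := by
      rw [Set.mem_Icc, not_and_or, not_le, not_le] at hx
      rcases hx with hx | hx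
      · simp [J, hx, hs.eq_zero (x - c) (by linarith)]
      · simp [J, (show c ≤ x by linarith), hs.eq_one (x - c) (by linarith)]
    have hJb (c x : ℝ) : ‖J c x‖ ≤ 2 := by
      refine (norm_sub_le _ _).trans ?_
      have h1 : ‖(Set.Ici c).indicator (fun _ => (1 : 𝕜)) x‖ ≤ 1 :=
        (norm_indicator_le_norm_self _ _).trans (by simp)
      linarith [hs.norm_le (x - c)]
    have hJm (c : ℝ) : MemLp (J c) (ENNReal.ofReal p) (volume.restrict I) := by
      have hmeas : AEStronglyMeasurable (J c) (volume.restrict I) :=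
        ((measurable_const.indicator measurableSet_Ici).aestronglyMeasurable).sub
          (hs.contDiff_comp_sub c).continuous.aestronglyMeasurable
      refine ((hstep c).const_mul 2).mono hmeas (ae_of_all _ fun x => ?_)
      by_cases hx : x ∈ Set.Icc c (c + ε)
      · simpa [Set.indicator_of_mem hx] using hJb c x
      · simp [Set.indicator_of_notMem hx, hJ0 c x hx]
    have hJi (c : ℝ) : ∫ x in I, ‖J c x‖ ^ (p : ℝ) ≤ 2 * ε := by
      refine (setIntegral_pow_le_of_support I p (a := c) (b := c + ε) (by linarith) (hJb c)
        (hJ0 c)).trans ?_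
      rw [add_sub_cancel_left]
      refine mul_le_mul_of_nonneg_right ?_ hε.le
      simpa using Real.rpow_le_rpow_of_exponent_le (x := 2) (by norm_num) p.2.2.le
    have hdecomp (x : ℝ) : (Set.Ico a b).indicator (fun _ => (1 : 𝕜)) x -
        (s (x - a) - s (x - b)) = J a x + -1 * J b x := by
      simp only [J, Set.indicator_apply, Set.mem_Ico, Set.mem_Ici]
      by_cases h1 : a ≤ x <;> by_cases h2 : b ≤ x <;> simp [h1, h2, not_lt.2, not_le.1] <;> grind
    simp_rw [hdecomp]
    refine (integral_pow_add_le (hJm a) ((hJm b).const_mul (-1))).trans ?_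
    rw [integral_pow_smul]
    simp only [norm_neg, norm_one, Real.one_rpow, one_mul]
    nlinarith [hJi a, hJi b]
  · refine (TestSpace.norm_le_of_iteratedDeriv _ (c := 2 * ε) fun i hi => ?_).trans ?_
    · rw [show ∀ f : TestSpace 𝕜 I (k + 1) p,
        iteratedDeriv i (TestSpace.derivCLM f : TestSpace 𝕜 I k p).toTest =
          iteratedDeriv (i + 1) f.toTest from fun f => iteratedDeriv_succ'.symm]
      exact (hs.integral_window_le p i a b).trans (by linarith [hsi i hi])
    · nlinarith

/-! ### Step functions and density in `L^p` -/

/-- The function equal to `g (j / n)` on `[j / n, (j + 1) / n)` for `-K ≤ j < K`. -/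
def stepApprox (g : ℝ → 𝕜) (n K : ℕ) (x : ℝ) : 𝕜 :=
  ∑ j ∈ Finset.Ico (-K : ℤ) K,
    g (j / n) * (Set.Ico (j / n : ℝ) ((j + 1) / n)).indicator (fun _ => (1 : 𝕜)) x

/-- The half-open cells are disjoint and `x` lies in the one with index `⌊n x⌋`, so at most one
summand survives. -/
lemma stepApprox_eq (g : ℝ → 𝕜) {n : ℕ} (hn : 0 < n) (K : ℕ) (x : ℝ) :
    stepApprox g n K x =
      if ⌊n * x⌋ ∈ Finset.Ico (-K : ℤ) K then g (⌊n * x⌋ / n) else 0 := by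
  have hn' : (0 : ℝ) < n := by exact_mod_cast hn
  rw [← Finset.sum_ite_eq' (Finset.Ico (-K : ℤ) K) ⌊n * x⌋ fun j => g (j / n), stepApprox]
  refine Finset.sum_congr rfl fun j _ => ?_
  have : x ∈ Set.Ico (j / n : ℝ) ((j + 1) / n) ↔ j = ⌊n * x⌋ := by
    rw [eq_comm, Int.floor_eq_iff, Set.mem_Ico, div_le_iff₀ hn', lt_div_iff₀ hn', mul_comm x]
  rw [Set.indicator_apply]
  simp [this]

lemma stepApprox_mem_flatSubmodule (g : ℝ → 𝕜) (n K : ℕ) :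
    ∃ h : MemLp (stepApprox g n K) (ENNReal.ofReal p) (volume.restrict I),
      LpSpace.mk (stepApprox g n K) h ∈ flatSubmodule 𝕜 I k p := by
  let φ (j : ℤ) (x : ℝ) : 𝕜 :=
    g (j / n) * (Set.Ico (j / n : ℝ) ((j + 1) / n)).indicator (fun _ => (1 : 𝕜)) x
  have hφ (j : ℤ) : MemLp (φ j) (ENNReal.ofReal p) (volume.restrict I) :=
    (memLp_indicator_Ico I _ (j / n : ℝ) ((j + 1) / n)).const_mul (g (j / n))
  have hφm (j : ℤ) : LpSpace.mk (φ j) (hφ j) ∈ flatSubmodule 𝕜 I k p := by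
    have hle : (j / n : ℝ) ≤ (j + 1) / n := by gcongr; linarith
    have h := Submodule.smul_mem _ (g (j / n))
      (indicator_mem_flatSubmodule (𝕜 := 𝕜) (I := I) (k := k) (p := p) hle)
    rwa [← LpSpace.mk_const_mul] at h
  have key : ∀ S : Finset ℤ, ∃ h : MemLp (fun x => ∑ j ∈ S, φ j x) (ENNReal.ofReal p)
      (volume.restrict I), LpSpace.mk _ h ∈ flatSubmodule 𝕜 I k p := fun S => by
    induction S using Finset.induction_on with
    | empty =>
      simp only [Finset.sum_empty]
      exact ⟨MemLp.zero', Submodule.zero_mem _⟩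
    | insert j S hj ih =>
      obtain ⟨h, hm⟩ := ih
      simp only [Finset.sum_insert hj]
      refine ⟨(hφ j).add h, ?_⟩
      rw [LpSpace.mk_add (hφ j) h]
      exact Submodule.add_mem _ (hφm j) hm
  exact key _

/-- With `K = n (M + 1)` the cells fill `[-(M+1), M+1)`. The extra unit ensures that the point `M`,
where `g` need not vanish, is covered in spite of the open right end. -/
lemma norm_sub_stepApprox_le {g : ℝ → 𝕜} {n M : ℕ} (hn : 0 < n) {c : ℝ}
    (hg : ∀ x y, |x - y| ≤ (n : ℝ)⁻¹ → ‖g x - g y‖ ≤ c)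
    (h0 : ∀ x : ℝ, (M : ℝ) < |x| → g x = 0) (x : ℝ) :
    ‖g x - stepApprox g n (n * (M + 1)) x‖ ≤ c := by
  have hn' : (0 : ℝ) < n := by exact_mod_cast hn
  have hc : 0 ≤ c := (norm_nonneg _).trans (hg 0 0 (by simp))
  rw [stepApprox_eq g hn]
  split_ifs with h
  · refine hg _ _ ?_
    have h1 := Int.floor_le (n * x)
    have h2 := Int.lt_floor_add_one (n * x)
    rw [show x - ⌊n * x⌋ / n = (n * x - ⌊n * x⌋) / n by field_simp, abs_of_nonneg
      (div_nonneg (by linarith) hn'.le), inv_eq_one_div]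
    gcongr
    linarith
  · rw [h0, sub_zero, norm_zero]
    · exact hc
    · by_contra! hx
      obtain ⟨h1, h2⟩ := abs_le.1 hx
      refine h (Finset.mem_Ico.2 ⟨Int.le_floor.2 ?_, Int.floor_lt.2 ?_⟩)
      · push_cast
        nlinarith
      · push_cast
        nlinarith

lemma stepApprox_eq_zero (g : ℝ → 𝕜) {n M : ℕ} (hn : 0 < n) {x : ℝ}
    (hx : x ∉ Set.Icc (-(M + 1) : ℝ) (M + 1)) : stepApprox g n (n * (M + 1)) x = 0 := by
  have hn' : (0 : ℝ) < n := by exact_mod_cast hn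
  rw [stepApprox_eq g hn, if_neg]
  rw [Finset.mem_Ico, Int.le_floor, Int.floor_lt]
  push_cast
  rintro ⟨h1, h2⟩
  exact hx ⟨by nlinarith, by nlinarith⟩

/-- By uniform continuity the step functions are within `c` of `g` everywhere and the error lives on
`[-(M+1), M+1]`, so it costs at most `c^p (2M + 2)`. -/
lemma continuous_mem_flatSubmodule {g : ℝ → 𝕜} (hg : Continuous g) (hc : HasCompactSupport g)
    (hm : MemLp g (ENNReal.ofReal p) (volume.restrict I)) :
    LpSpace.mk g hm ∈ flatSubmodule 𝕜 I k p := by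
  obtain ⟨R, hR⟩ := hc.isCompact.isBounded.subset_closedBall 0
  obtain ⟨M, hM⟩ := exists_nat_ge R
  have h0 (x : ℝ) (hx : (M : ℝ) < |x|) : g x = 0 := by
    refine image_eq_zero_of_notMem_tsupport fun h => ?_
    have := mem_closedBall_zero_iff.1 (hR h)
    rw [Real.norm_eq_abs] at this
    linarith
  rw [← SetLike.mem_coe, ← isClosed_flatSubmodule.closure_eq, Metric.mem_closure_iff]
  intro ε hε
  have hlim : Tendsto (fun c : ℝ => c ^ (p : ℝ) * ((M + 1 : ℝ) - -(M + 1))) (𝓝 0) (𝓝 0) := by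
    have h2 := (Real.continuousAt_rpow_const 0 (p : ℝ) (Or.inr (p_pos p).le)).tendsto.mul_const
      ((M + 1 : ℝ) - -(M + 1))
    rwa [Real.zero_rpow (p_pos p).ne', zero_mul] at h2
  obtain ⟨c, h2, hc0⟩ := (((hlim.eventually (gt_mem_nhds hε)).filter_mono
    nhdsWithin_le_nhds).and (self_mem_nhdsWithin (s := Set.Ioi (0 : ℝ)))).exists
  obtain ⟨d, hd, hgd⟩ := Metric.uniformContinuous_iff.1
    (hc.uniformContinuous_of_continuous hg) c hc0
  obtain ⟨n, hn⟩ := exists_nat_one_div_lt hd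
  obtain ⟨hs, hs'⟩ := stepApprox_mem_flatSubmodule (I := I) (k := k) (p := p) g (n + 1)
    ((n + 1) * (M + 1))
  refine ⟨_, hs', ?_⟩
  rw [dist_eq_norm, norm_mk_sub_mk]
  refine (setIntegral_pow_le_of_support I p (a := -(M + 1)) (b := M + 1) (c := c)
    (by linarith [(M.cast_nonneg : (0 : ℝ) ≤ M)]) (norm_sub_stepApprox_le n.succ_pos
      (fun x y hxy => ?_) h0) fun x hx => ?_).trans_lt h2
  · rw [← dist_eq_norm]
    refine (hgd ?_).le
    rw [Real.dist_eq]
    refine hxy.trans_lt ?_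
    rwa [inv_eq_one_div, Nat.cast_succ]
  · rw [stepApprox_eq_zero g n.succ_pos hx, sub_zero]
    refine h0 x ?_
    by_contra! hx'
    obtain ⟨h3, h4⟩ := abs_le.1 hx'
    exact hx ⟨by linarith, by linarith⟩

lemma LpSpace.exists_continuous_approx (g : LpSpace 𝕜 I p) {ε : ℝ} (hε : 0 < ε) :
    ∃ (G : ℝ → 𝕜) (hG : MemLp G (ENNReal.ofReal p) (volume.restrict I)),
      Continuous G ∧ HasCompactSupport G ∧ ‖g - LpSpace.mk G hG‖ ≤ ε := by
  -- The tolerance `ε` is for the p-th power, hence `ε^(1/p)` for the quasi-norm.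
  obtain ⟨G, hGc, hle, hcont, hm⟩ := (Lp.memLp g.toLp).exists_hasCompactSupport_eLpNorm_sub_le
    ENNReal.ofReal_ne_top (ε := ENNReal.ofReal (ε ^ (p : ℝ)⁻¹)) (by
      rw [Ne, ENNReal.ofReal_eq_zero, not_le]; positivity)
  refine ⟨G, hm, hcont, hGc, ?_⟩
  rw [LpSpace.eLpNorm_eq ((Lp.memLp g.toLp).sub hm),
    ENNReal.ofReal_le_ofReal_iff (by positivity)] at hle
  have h1 : g = LpSpace.mk g.toLp (Lp.memLp g.toLp) := (Lp.toLp_coeFn g.toLp _).symm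
  rw [h1, norm_mk_sub_mk]
  exact (Real.rpow_le_rpow_iff (integral_nonneg fun x => by positivity) hε.le
    (inv_pos.2 (p_pos p))).1 hle

lemma forall_mem_flatSubmodule (g : LpSpace 𝕜 I p) : g ∈ flatSubmodule 𝕜 I k p := by
  rw [← SetLike.mem_coe, ← isClosed_flatSubmodule.closure_eq, Metric.mem_closure_iff]
  intro ε hε
  obtain ⟨G, hm, hG, hc, hle⟩ := g.exists_continuous_approx (half_pos hε)
  refine ⟨_, continuous_mem_flatSubmodule hG hc hm, ?_⟩
  rw [dist_eq_norm]
  linarith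

/-! ### Pairs `(0, w)` and surjectivity -/

/-- Every test function is, up to a small error in `W^{k,p}`, the derivative of a test function. -/
lemma TestSpace.exists_derivCLM_approx (f : TestSpace 𝕜 I k p) {ε : ℝ} (hε : 0 < ε) :
    ∃ F : TestSpace 𝕜 I (k + 1) p, ‖f - derivCLM F‖ ≤ ε := by
  obtain ⟨R, hR⟩ := f.hasCompactSupport.isCompact.isBounded.subset_closedBall 0
  -- Nonnegativity of `M` makes the staircase that starts at `M` vanish to the left of `-M`.
  set M : ℝ := max R 0
  have h0 (x : ℝ) (hx : M < |x|) : f.toTest x = 0 := by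
    refine image_eq_zero_of_notMem_tsupport fun h => ?_
    have := mem_closedBall_zero_iff.1 (hR h)
    rw [Real.norm_eq_abs] at this
    linarith [le_max_left R 0]
  have hM : 0 ≤ M := le_max_right R 0
  have hcont := f.contDiff.continuous
  let P (x : ℝ) : 𝕜 := ∫ t in (-M)..x, f.toTest t
  let c : 𝕜 := P M
  have hP (x : ℝ) : HasDerivAt P (f.toTest x) x :=
    (hcont.integral_hasStrictDerivAt (-M) x).hasDerivAt
  have hP0 (x : ℝ) (hx : x < -M) : P x = 0 := by
    refine (intervalIntegral.integral_congr_ae (g := fun _ => (0 : 𝕜))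
      (ae_of_all _ fun t ht => ?_)).trans (by simp)
    rw [Set.uIoc_of_ge hx.le] at ht
    -- At the endpoint `h0` says nothing; the value is 0 by continuity from the left.
    by_cases h : t = -M
    · rw [h]
      have : Tendsto f.toTest (𝓝[<] (-M)) (𝓝 (f.toTest (-M))) :=
        hcont.continuousWithinAt
      refine tendsto_nhds_unique this (tendsto_const_nhds.congr' ?_)
      filter_upwards [self_mem_nhdsWithin] with y hy
      have hy' : y < -M := hy
      exact (h0 y (by rw [lt_abs]; right; linarith)).symm
    · have : t < -M := lt_of_le_of_ne ht.2 h
      exact h0 t (by rw [lt_abs]; right; linarith)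
  have hPc (x : ℝ) (hx : M ≤ x) : P x = c := by
    have h1 : ∫ t in M..x, f.toTest t = 0 := by
      refine (intervalIntegral.integral_congr_ae (g := fun _ => (0 : 𝕜))
        (ae_of_all _ fun t ht => ?_)).trans (by simp)
      rw [Set.uIoc_of_le hx] at ht
      exact h0 t (ht.1.trans_le (le_abs_self t))
    have h2 := intervalIntegral.integral_add_adjacent_intervals
      (hcont.intervalIntegrable (μ := volume) (-M) M) (hcont.intervalIntegrable M x)
    rw [h1, add_zero] at h2
    exact h2.symm
  have hPs : ContDiff ℝ ((⊤ : ℕ∞) : WithTop ℕ∞) P := by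
    rw [contDiff_infty_iff_deriv]
    refine ⟨fun x => (hP x).differentiableAt, ?_⟩
    rw [show deriv P = f.toTest from funext fun x => (hP x).deriv]
    exact f.contDiff
  -- Budget for `k + 1` derivatives of `c s`, each costing at most `‖c‖^p η`.
  obtain ⟨η, hη, hηε⟩ : ∃ η : ℝ, 0 < η ∧ (k + 1) * (‖c‖ ^ (p : ℝ) * η) ≤ ε := by
    refine ⟨ε / ((k + 1) * (‖c‖ ^ (p : ℝ) + 1)), by positivity, ?_⟩
    rw [← mul_assoc, ← mul_div_assoc, div_le_iff₀ (by positivity)]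
    nlinarith [(k.cast_nonneg : (0 : ℝ) ≤ k)]
  obtain ⟨s, hs, hsi⟩ := exists_isStaircase 𝕜 p (k + 1) η hη
  have hS : ContDiff ℝ ((⊤ : ℕ∞) : WithTop ℕ∞) fun x => c * s (x - M) :=
    contDiff_const.mul (hs.contDiff_comp_sub M)
  -- The primitive `P` stays at `c = ∫ f` beyond `M`; subtracting `c` times the staircase returns it
  -- to 0.
  have hcs : HasCompactSupport fun x => P x - c * s (x - M) := by
    refine HasCompactSupport.intro (isCompact_Icc (a := -M) (b := M + η)) fun x hx => ?_
    rw [Set.mem_Icc, not_and_or, not_le, not_le] at hx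
    rcases hx with hx | hx
    · rw [hP0 x hx, hs.eq_zero _ (by linarith), mul_zero, sub_zero]
    · rw [hPc x (by linarith), hs.eq_one _ (by linarith), mul_one, sub_self]
  refine ⟨TestSpace.mk _ (hPs.sub hS) hcs, ?_⟩
  refine (norm_le_of_iteratedDeriv _ fun i hi => ?_).trans hηε
  -- Since `P' = f`, the error is exactly the derivative of the staircase term, so its derivatives
  -- of order `0, …, k` are those of order `1, …, k + 1` of that term.
  have hdiff : (f - derivCLM (mk (I := I) (k := k + 1) (p := p) _ (hPs.sub hS) hcs)).toTest =
      (deriv fun x => c * s (x - M)) := by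
    funext x
    have hd := (hP x).sub ((hS.differentiable (by simp)) x).hasDerivAt
    change f.toTest x - deriv (fun x => P x - c * s (x - M)) x = _
    rw [show deriv (fun x => P x - c * s (x - M)) x = _ from hd.deriv, sub_sub_cancel]
  rw [hdiff, ← iteratedDeriv_succ', IsStaircase.integral_comp_sub]
  exact mul_le_mul_of_nonneg_left (hsi i hi) (by positivity)

lemma surjective_alphaDelta : Function.Surjective (alphaDelta 𝕜 I k p) := by
  have hR (g : LpSpace 𝕜 I p) : ∃ f, alphaDelta 𝕜 I k p f = (g, 0) := forall_mem_flatSubmodule g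
  have hclosed : IsClosed {w : W 𝕜 I k p | ((0 : LpSpace 𝕜 I p), w) ∈
      Set.range (alphaDelta 𝕜 I k p)} := isClosed_range_alphaDelta.preimage (by fun_prop)
  have hW (w : W 𝕜 I k p) : ((0 : LpSpace 𝕜 I p), w) ∈ Set.range (alphaDelta 𝕜 I k p) := by
    induction w using UniformSpace.Completion.induction_on with
    | hp => exact hclosed
    | ih f =>
      rw [← isClosed_range_alphaDelta.closure_eq, Metric.mem_closure_range_iff]
      intro ε hε
      obtain ⟨F, hF⟩ := f.exists_derivCLM_approx (half_pos hε)
      -- Subtracting a lift of `(F, 0)` removes the `L^p` component without changing the derivative: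
      -- `F - u` is sent to `(0, F')`.
      obtain ⟨u, hu⟩ := hR (TestSpace.toLpSpace F)
      refine ⟨(F : W 𝕜 I (k + 1) p) - u, ?_⟩
      have h1 : alphaDelta 𝕜 I k p F =
          (TestSpace.toLpSpace F, ((TestSpace.derivCLM F : TestSpace 𝕜 I k p) : W 𝕜 I k p)) :=
        Prod.ext (alpha_coe F) (delta_coe F)
      rw [map_sub, hu, h1, dist_eq_norm, Prod.norm_def]
      refine max_lt ?_ ?_
      · simpa using hε
      · simp only [Prod.snd_sub, sub_zero]
        rw [← UniformSpace.Completion.coe_sub, UniformSpace.Completion.norm_coe]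
        linarith
  rintro ⟨g, w⟩
  obtain ⟨u, hu⟩ := hR g
  obtain ⟨v, hv⟩ := hW w
  exact ⟨u + v, by rw [map_add, hu, hv]; simp⟩

variable (𝕜 I k p) in
/-- The isomorphism `(α, δ) : W^{k+1,p} ≃ L^p × W^{k,p}`. -/
def alphaDeltaEquiv : W 𝕜 I (k + 1) p ≃L[𝕜] LpSpace 𝕜 I p × W 𝕜 I k p :=
  let e := LinearEquiv.ofBijective (alphaDelta 𝕜 I k p).toLinearMap
    ⟨antilipschitz_alphaDelta.injective, surjective_alphaDelta⟩
  { e with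
    continuous_toFun := (alphaDelta 𝕜 I k p).continuous
    continuous_invFun :=
      (antilipschitz_alphaDelta.to_rightInverse (g := e.symm) e.apply_symm_apply).continuous }

lemma alpha_alphaDeltaEquiv_symm (x : LpSpace 𝕜 I p × W 𝕜 I k p) :
    alpha 𝕜 I (k + 1) p ((alphaDeltaEquiv 𝕜 I k p).symm x) = x.1 :=
  congrArg Prod.fst ((alphaDeltaEquiv 𝕜 I k p).apply_symm_apply x)

lemma delta_alphaDeltaEquiv_symm (x : LpSpace 𝕜 I p × W 𝕜 I k p) :
    delta 𝕜 I k p ((alphaDeltaEquiv 𝕜 I k p).symm x) = x.2 :=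
  congrArg Prod.snd ((alphaDeltaEquiv 𝕜 I k p).apply_symm_apply x)

end Isomorphism

end SmallSobolev

end

open SmallSobolev in
theorem lemma3 (𝕜 : Type*) [RCLike 𝕜] (I : Set ℝ) (hI : I.OrdConnected)
    (p : Set.Ioo (0 : ℝ) 1) (k : ℕ) :
    Function.Surjective (delta 𝕜 I k p) ∧
    (∃ β : LpSpace 𝕜 I p →L[𝕜] W 𝕜 I (k + 1) p,
      (Function.Injective β ∧
        alpha 𝕜 I (k + 1) p ∘L β = ContinuousLinearMap.id 𝕜 (LpSpace 𝕜 I p) ∧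
        delta 𝕜 I k p ∘L β = 0) ∧
      (∀ β' : LpSpace 𝕜 I p →L[𝕜] W 𝕜 I (k + 1) p,
        alpha 𝕜 I (k + 1) p ∘L β' = ContinuousLinearMap.id 𝕜 (LpSpace 𝕜 I p) →
        delta 𝕜 I k p ∘L β' = 0 → β' = β) ∧
      {f : W 𝕜 I (k + 1) p | delta 𝕜 I k p f = 0} = Set.range β) ∧
    (∃ γ : W 𝕜 I k p →L[𝕜] W 𝕜 I (k + 1) p,
      delta 𝕜 I k p ∘L γ = ContinuousLinearMap.id 𝕜 (W 𝕜 I k p) ∧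
      alpha 𝕜 I (k + 1) p ∘L γ = 0) := by
  let e := alphaDeltaEquiv 𝕜 I k p
  have hα (x) : alpha 𝕜 I (k + 1) p (e.symm x) = x.1 := alpha_alphaDeltaEquiv_symm x
  have hδ (x) : delta 𝕜 I k p (e.symm x) = x.2 := delta_alphaDeltaEquiv_symm x
  let β := (e.symm : LpSpace 𝕜 I p × W 𝕜 I k p →L[𝕜] W 𝕜 I (k + 1) p) ∘L
    ContinuousLinearMap.inl 𝕜 (LpSpace 𝕜 I p) (W 𝕜 I k p)
  let γ := (e.symm : LpSpace 𝕜 I p × W 𝕜 I k p →L[𝕜] W 𝕜 I (k + 1) p) ∘L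
    ContinuousLinearMap.inr 𝕜 (LpSpace 𝕜 I p) (W 𝕜 I k p)
  have hβα (g) : alpha 𝕜 I (k + 1) p (β g) = g := hα (g, 0)
  have hβδ (g) : delta 𝕜 I k p (β g) = 0 := hδ (g, 0)
  have hγα (w) : alpha 𝕜 I (k + 1) p (γ w) = 0 := hα (0, w)
  have hγδ (w) : delta 𝕜 I k p (γ w) = w := hδ (0, w)
  -- Both sides are sent to `(α f, 0)` by the isomorphism. This yields the description of the kernel
  -- and, applied to `β' g`, uniqueness.
  have hker (f : W 𝕜 I (k + 1) p) (hf : delta 𝕜 I k p f = 0) :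
      f = β (alpha 𝕜 I (k + 1) p f) := by
    refine e.injective (Prod.ext (hβα _).symm ?_)
    exact hf.trans (hβδ _).symm
  refine ⟨fun w => ⟨γ w, hγδ w⟩, ⟨β, ⟨Function.LeftInverse.injective hβα,
    ContinuousLinearMap.ext hβα, ContinuousLinearMap.ext hβδ⟩, fun β' h1 h2 => ?_, ?_⟩,
    γ, ContinuousLinearMap.ext hγδ, ContinuousLinearMap.ext hγα⟩
  · ext1 g
    have h3 : alpha 𝕜 I (k + 1) p (β' g) = g := congrArg (fun T => T g) h1
    have h4 := hker (β' g) (congrArg (fun T => T g) h2)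
    rwa [h3] at h4
  · ext f
    refine ⟨fun hf => ⟨_, (hker f hf).symm⟩, ?_⟩
    rintro ⟨g, rfl⟩
    exact hβδ g
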